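/- Let $p,q$ be natural numbers with $q\ge 1$ and $\gcd(p,q)=1$, and let $\lambda=e^{2\pi i p/q}$. Let $F:\mathbb{C}\to\mathbb{C}$ be the piecewise rotation $F(z)=\lambda\,(z-H(z))$, where $H(z)=1$ if $\operatorname{Im} z\ge 0$ and $H(z)=-1$ if $\operatorname{Im} z<0$. Let $$\mathcal{F}=\{z\in\mathbb{C} : \operatorname{Im}(F^i(z))=0 \text{ for some integer } i\ge 0\}$$ be the critical set of $F$, let $\overline{\mathcal{F}}$ be its closure in $\mathbb{C}$, and let $$\mathcal{G}=\bigcup_{i=1}^{\infty}F^i(\mathbb{R}),$$ where $\mathbb{R}\subset\mathbb{C}$ is the real axis. Then: (a) every point $z\in\overline{\mathcal{F}}\setminus\mathcal{F}$ is aperiodic, that is, $F^n(z)\ne z$ for every integer $n\ge 1$; (b) $\mathcal{G}\subset\overline{\mathcal{F}}$. -/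

import Mathlib

noncomputable section

namespace PiecewiseRotation

/-- The sign-type function `H`: `1` on the closed upper half-plane, `-1` on the open lower one. -/
def H (z : ℂ) : ℂ := if 0 ≤ z.im then 1 else -1

/-- The piecewise rotation `F_lam(z) = lam * (z - H(z))`. -/
def F (lam : ℂ) (z : ℂ) : ℂ := lam * (z - H z)

/-- The real axis (discontinuity line) as a subset of `ℂ`. -/
def realLine : Set ℂ := Set.range ((↑) : ℝ → ℂ)

/-- The critical set: all points some iterate (possibly the zeroth) of which has
zero imaginary part. -/
def criticalSet (lam : ℂ) : Set ℂ := {z | ∃ i : ℕ, ((F lam)^[i] z).im = 0}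

/-- The forward critical set: the union of the images of the real axis under the iterates
`F^i`, `i ≥ 1`. -/
def forwardCriticalSet (lam : ℂ) : Set ℂ := ⋃ (i : ℕ) (_ : 1 ≤ i), (F lam)^[i] '' realLine

/-- A point is aperiodic if it is not periodic, i.e. no positive iterate returns it to itself. -/
def IsAperiodic (f : ℂ → ℂ) (z : ℂ) : Prop := z ∉ Function.periodicPts f

end PiecewiseRotation

end

open Real

noncomputable section

namespace PiecewiseRotation

/-! For (a): a periodic orbit that misses the real axis keeps some distance `δ > 0` from it. A point
within `δ` of the orbit is always on the same side of the axis as the point it follows, so the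
distance is preserved and the axis is never met. A periodic point off the critical set therefore has
a neighbourhood off it.

For (b): suppose `w = F^i(t)`, `t` real, has a disc around it disjoint from the critical set. Every
iterate is a rotation on that disc, and the iterates `F^(q * m)` are translations. If the orbit of
`w` is bounded, two of these translates come closer than the radius; their displacement then repeats
forever, so boundedness forces it to vanish and `w` is eventually periodic
(`exists_periodic_iterate`). As `F` is injective, `t` itself is periodic, so the orbit of `w`
returns to the axis, a contradiction.

The hard part is boundedness (`exists_norm_iterate_le`). Write `lam = dir (2 * r * α)` with `α = π /
(2 * h)` and `r / h = 2p / q` in lowest terms. For `h ≥ 2`, any point lies in a large, nearly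
regular, centrally symmetric `2h`-gon with regular unit-sided `2h`-gons strung along its boundary,
touching at vertices. `F` permutes these tiles, none of which crosses the axis, and a point pushed
out of the polygon lands in a tile (`IsNecklace.step_mem`). Such necklaces come from solving a
cohomological equation for the support numbers, with side lengths integral multiples of the tile
diameter (`exists_displacement`, `exists_isNecklace`). For `h = 1`, `lam = ±1` and the axis is
invariant. -/

/-- The unit vector at angle `θ`. -/
def dir (θ : ℝ) : ℂ := ⟨cos θ, sin θ⟩

@[simp] lemma dir_re (θ : ℝ) : (dir θ).re = cos θ := rfl

@[simp] lemma dir_im (θ : ℝ) : (dir θ).im = sin θ := rfl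

lemma dir_mul_dir (θ φ : ℝ) : dir θ * dir φ = dir (θ + φ) := by
  apply Complex.ext <;> simp [cos_add, sin_add]; ring

lemma dir_add_pi (θ : ℝ) : dir (θ + π) = -dir θ := by
  apply Complex.ext <;> simp

lemma dir_eq_exp (θ : ℝ) : dir θ = Complex.exp (θ * Complex.I) := by
  apply Complex.ext
  · rw [Complex.exp_ofReal_mul_I_re, dir_re]
  · rw [Complex.exp_ofReal_mul_I_im, dir_im]

/-! ### Polygons, tiles and necklaces -/

/-- The corner of the polygon with support numbers `s` between its sides `j - 1` and `j`. -/
def corner (α : ℝ) (s : ℤ → ℝ) (j : ℤ) : ℂ :=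
  dir (2 * j * α) * ⟨(s j + s (j - 1)) / (2 * cos α), (s j - s (j - 1)) / (2 * sin α)⟩

/-- The centre of the `k`-th tile on the side `j` of the polygon with support numbers `s`. -/
def bead (α : ℝ) (s : ℤ → ℝ) (j k : ℤ) : ℂ :=
  corner α s j + ⟨-(k * sin ((2 * j + 1) * α) / sin α), k * cos ((2 * j + 1) * α) / sin α⟩

/-- The polygon with outer normals at the angles `(2 * j + 1) * α` and support numbers `s`. -/
def polygon (α : ℝ) (s : ℤ → ℝ) : Set ℂ :=
  {z | ∀ j : ℤ, z.re * cos ((2 * j + 1) * α) + z.im * sin ((2 * j + 1) * α) ≤ s j}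

/-- The regular polygon with unit sides parallel to the lines at the angles `2 * k * α`,
centred at `w`. -/
def tile (α : ℝ) (w : ℂ) : Set ℂ :=
  {z | ∀ k : ℤ, |(dir (2 * k * α) * (z - w)).im| ≤ cos α / (2 * sin α)}

/-- The polygon with support numbers `s` together with a necklace of tiles along its boundary,
the side `j` carrying `n j` of them. -/
def necklaceRegion (α : ℝ) (s : ℤ → ℝ) (n : ℤ → ℤ) : Set ℂ :=
  {z | z ∈ polygon α s ∨ ∃ j k : ℤ, 0 ≤ k ∧ k < n j ∧ z ∈ tile α (bead α s j k)}

/-- Conditions under which the necklace of tiles along the polygon with support numbers `s` is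
permuted by the piecewise rotation by the angle `2 * r * α`. -/
structure IsNecklace (h : ℕ) (r : ℤ) (α : ℝ) (s : ℤ → ℝ) (n : ℤ → ℤ) : Prop where
  two_le : 2 ≤ h
  angle : 2 * h * α = π
  periodic : Function.Periodic s h
  -- Translation by `-1` and rotation by `2 * r * α` carry the lines of the sides with upward
  -- normals to lines of sides.
  step : ∀ j : ℤ, 0 ≤ j → j < h → s (j + r) = s j - cos ((2 * j + 1) * α)
  -- The tile at corner `0` rests on the real axis.
  start : s 0 - s (-1) = cos α
  -- Side `j` has length `n j / sin α`, and `1 / sin α` is the circumdiameter of a tile.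
  count : ∀ j, s (j + 1) + s (j - 1) - 2 * cos (2 * α) * s j = 2 * cos α * n j
  count_pos : ∀ j, 0 < n j
  -- Near-regularity: this controls the sides whose normals are far from horizontal.
  large : ∀ j k, cos (3 * α) * s j ≤ cos α * s k
  pos : ∀ j, 0 < s j
  height : ∀ j : ℤ, 1 ≤ j → j < h → cos α / (2 * sin α) ≤ (corner α s j).im

namespace IsNecklace

variable {h : ℕ} {r : ℤ} {α : ℝ} {s : ℤ → ℝ} {n : ℤ → ℤ}

lemma angle_pos (N : IsNecklace h r α s n) : 0 < α := by
  have h1 : (2 : ℝ) ≤ h := by exact_mod_cast N.two_le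
  have := N.angle
  have := pi_pos
  by_contra! hc
  nlinarith

lemma angle_le (N : IsNecklace h r α s n) : 4 * α ≤ π := by
  have h1 : (2 : ℝ) ≤ h := by exact_mod_cast N.two_le
  have := N.angle
  have := N.angle_pos
  nlinarith

lemma sin_pos (N : IsNecklace h r α s n) : 0 < sin α :=
  sin_pos_of_pos_of_lt_pi N.angle_pos (by linarith [N.angle_le, N.angle_pos])

lemma cos_pos (N : IsNecklace h r α s n) : 0 < cos α :=
  cos_pos_of_mem_Ioo ⟨by linarith [N.angle_pos, pi_pos], by linarith [N.angle_le, N.angle_pos]⟩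

lemma sin_two_pos (N : IsNecklace h r α s n) : 0 < sin (2 * α) := by
  rw [sin_two_mul]; have := N.sin_pos; have := N.cos_pos; positivity

lemma count_periodic (N : IsNecklace h r α s n) : Function.Periodic n h := by
  intro j
  have h1 := N.count j
  have h2 := N.count (j + h)
  rw [show j + h + 1 = j + 1 + h by ring, show j + h - 1 = j - 1 + h by ring, N.periodic,
    N.periodic, N.periodic, h1] at h2
  have := mul_left_cancel₀ (by have := N.cos_pos; positivity) h2
  exact_mod_cast this.symm

lemma corner_add (N : IsNecklace h r α s n) (j : ℤ) : corner α s (j + h) = -corner α s j := by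
  unfold corner
  rw [show j + h - 1 = j - 1 + h by ring, N.periodic, N.periodic,
    show 2 * ((j + h : ℤ) : ℝ) * α = 2 * j * α + π by rw [← N.angle]; push_cast; ring, dir_add_pi]
  ring

lemma angle_add (N : IsNecklace h r α s n) (j : ℤ) :
    (2 * ((j + h : ℤ) : ℝ) + 1) * α = (2 * j + 1) * α + π := by
  rw [← N.angle]; push_cast; ring

lemma bead_add (N : IsNecklace h r α s n) (j k : ℤ) : bead α s (j + h) k = -bead α s j k := by
  unfold bead
  rw [N.corner_add, N.angle_add, sin_add_pi, cos_add_pi]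
  apply Complex.ext <;> simp <;> ring

lemma bead_count (N : IsNecklace h r α s n) (j : ℤ) :
    bead α s j (n j) = bead α s (j + 1) 0 := by
  have hs := N.sin_pos.ne'
  have hc := N.cos_pos.ne'
  have hn : (n j : ℝ) = (s (j + 1) + s (j - 1) - 2 * cos (2 * α) * s j) / (2 * cos α) := by
    rw [N.count]; field_simp
  have h2 : cos (2 * α) = 1 - 2 * sin α ^ 2 := by rw [cos_two_mul, cos_sq']; ring
  have hcc : cos α ^ 2 = 1 - sin α ^ 2 := cos_sq' α
  unfold bead corner
  rw [hn, h2]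
  have e1 : 2 * (j : ℝ) * α = (2 * j + 1) * α - α := by ring
  have e2 : 2 * ((j + 1 : ℤ) : ℝ) * α = (2 * j + 1) * α + α := by push_cast; ring
  rw [e1, e2]
  generalize (2 * (j : ℝ) + 1) * α = φ
  apply Complex.ext <;>
    simp only [Complex.add_re, Complex.add_im, Complex.mul_re, Complex.mul_im, dir_re, dir_im,
      cos_add, sin_add, cos_sub, sin_sub, add_sub_cancel_right, Int.cast_zero, zero_mul, zero_div,
      neg_zero, add_zero] <;>
    field_simp <;> ring_nf <;>
    simp only [hcc] <;> ring

end IsNecklace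

/-! ### Action of the piecewise rotation on corners, tile centres and tile counts -/

namespace IsNecklace

variable {h : ℕ} {r : ℤ} {α : ℝ} {s : ℤ → ℝ} {n : ℤ → ℤ}

/-- Reduction of an index modulo the number of lines. -/
lemma exists_rep (N : IsNecklace h r α s n) (j : ℤ) :
    ∃ i m : ℤ, 0 ≤ i ∧ i < h ∧ j = i + m * h := by
  have hh : (0 : ℤ) < h := by exact_mod_cast (lt_of_lt_of_le two_pos N.two_le)
  exact ⟨j % h, j / h, Int.emod_nonneg _ hh.ne', Int.emod_lt_of_pos _ hh,
    by rw [mul_comm]; exact (Int.emod_add_mul_ediv j h).symm⟩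

lemma angle_mem (N : IsNecklace h r α s n) {i : ℤ} (h0 : 0 ≤ i) (h1 : i < h) :
    α ≤ (2 * i + 1) * α ∧ (2 * i + 1) * α ≤ π - α := by
  have hα := N.angle_pos
  have a0 : (0 : ℝ) ≤ i := by exact_mod_cast h0
  have a1 : (i : ℝ) + 1 ≤ h := by exact_mod_cast h1
  rw [← N.angle]
  constructor <;> nlinarith

lemma abs_cos_le (N : IsNecklace h r α s n) (j : ℤ) : |cos ((2 * j + 1) * α)| ≤ cos α := by
  obtain ⟨i, m, h0, h1, rfl⟩ := N.exists_rep j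
  have e : (2 * ((i + m * h : ℤ) : ℝ) + 1) * α = (2 * i + 1) * α + m * π := by
    rw [← N.angle]; push_cast; ring
  rw [e, cos_add_int_mul_pi, abs_mul, abs_zpow, abs_neg, abs_one, one_zpow, one_mul]
  obtain ⟨h2, h3⟩ := N.angle_mem h0 h1
  have hα := N.angle_pos
  have hp := pi_pos
  rw [abs_le]
  constructor
  · rw [← cos_pi_sub]
    exact cos_le_cos_of_nonneg_of_le_pi (by linarith) (by linarith) h3
  · exact cos_le_cos_of_nonneg_of_le_pi hα.le (by linarith) h2

lemma abs_cos_middle_le (N : IsNecklace h r α s n) {i : ℤ} (h0 : 1 ≤ i) (h1 : i + 1 < h) :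
    |cos ((2 * i + 1) * α)| ≤ cos (3 * α) := by
  have hα := N.angle_pos
  have a0 : (1 : ℝ) ≤ i := by exact_mod_cast h0
  have a1 : (i : ℝ) + 2 ≤ h := by exact_mod_cast (by lia : i + 2 ≤ h)
  have h2 : 3 * α ≤ (2 * i + 1) * α := by nlinarith
  have h3 : (2 * i + 1) * α ≤ π - 3 * α := by rw [← N.angle]; nlinarith
  rw [abs_le]
  constructor
  · rw [← cos_pi_sub]
    exact cos_le_cos_of_nonneg_of_le_pi (by linarith) (by linarith) h3
  · exact cos_le_cos_of_nonneg_of_le_pi (by linarith) (by linarith) h2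

/-- Both sides meeting at this corner have upward normals, so `step` applies to each of them. -/
lemma corner_step (N : IsNecklace h r α s n) {j : ℤ} (h0 : 1 ≤ j) (h1 : j < h) :
    dir (2 * r * α) * (corner α s j - 1) = corner α s (j + r) := by
  have hs := N.sin_pos.ne'
  have hc := N.cos_pos.ne'
  unfold corner
  rw [show j + r - 1 = j - 1 + r by ring, N.step j (by lia) h1, N.step (j - 1) (by lia) (by lia),
    show 2 * ((j + r : ℤ) : ℝ) * α = 2 * r * α + 2 * j * α by push_cast; ring, ← dir_mul_dir,
    mul_assoc (dir (2 * r * α))]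
  congr 1
  rw [show (2 * (j : ℝ) + 1) * α = 2 * j * α + α by ring,
    show (2 * ((j - 1 : ℤ) : ℝ) + 1) * α = 2 * j * α - α by push_cast; ring]
  generalize 2 * (j : ℝ) * α = φ
  have h2 := sin_sq_add_cos_sq φ
  apply Complex.ext <;>
    simp only [Complex.sub_re, Complex.sub_im, Complex.mul_re, Complex.mul_im, dir_re, dir_im,
      cos_add, cos_sub, Complex.one_re, Complex.one_im] <;>
    field_simp <;> ring_nf
  · rw [show sin φ ^ 2 = 1 - cos φ ^ 2 by linarith]; ring

/-- Side `0` is carried to the line of side `r`, but side `-1` is opposite to side `h - 1`, so its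
support number changes with the wrong sign. The mismatch `2 * cos α` moves the image along side `r`
by `2 * cos α / sin (2 * α) = 1 / sin α`, exactly one tile. -/
lemma corner_zero_step (N : IsNecklace h r α s n) :
    dir (2 * r * α) * (bead α s 0 0 - 1) = bead α s r 1 := by
  have hs := N.sin_pos.ne'
  have hc := N.cos_pos.ne'
  have hh := N.two_le
  have e0 : s r = s 0 - cos α := by simpa using N.step 0 le_rfl (by lia)
  have e1 : s (r - 1) = s (-1) + cos α := by
    have := N.step (h - 1) (by lia) (by lia)
    rw [show (h : ℤ) - 1 + r = r - 1 + h by ring, show (h : ℤ) - 1 = -1 + h by ring, N.periodic,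
      N.periodic, N.angle_add, cos_add_pi] at this
    rw [this]; norm_num
  unfold bead corner
  rw [e0, e1, show (2 * (r : ℝ) + 1) * α = 2 * r * α + α by ring]
  generalize 2 * (r : ℝ) * α = φ
  apply Complex.ext <;>
    simp [cos_add, sin_add] <;>
    field_simp <;> ring

lemma bead_sub (j k : ℤ) : bead α s j k = bead α s j 0 +
    ⟨-(k * sin ((2 * j + 1) * α) / sin α), k * cos ((2 * j + 1) * α) / sin α⟩ := by
  unfold bead
  apply Complex.ext <;> simp

/-- The piecewise rotation permutes the centres of the tiles. -/
lemma bead_step (N : IsNecklace h r α s n) {j : ℤ} (h0 : 0 ≤ j) (h1 : j < h) (k : ℤ) :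
    dir (2 * r * α) * (bead α s j k - 1) = bead α s (j + r) (k + if j = 0 then 1 else 0) := by
  have key : dir (2 * r * α) * (bead α s j 0 - 1) =
      bead α s (j + r) (if j = 0 then 1 else 0) := by
    split_ifs with hj
    · subst hj; rw [zero_add]; exact N.corner_zero_step
    · have := N.corner_step (by lia : 1 ≤ j) h1
      unfold bead
      rw [← this]
      apply Complex.ext <;> simp
  rw [bead_sub j k, bead_sub (j + r) (k + _), add_sub_right_comm, mul_add, key,
    bead_sub (j + r) (if j = 0 then 1 else 0),
    show (2 * ((j + r : ℤ) : ℝ) + 1) * α = 2 * r * α + (2 * j + 1) * α by push_cast; ring]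
  generalize (if j = 0 then 1 else 0 : ℤ) = e
  apply Complex.ext <;> simp [cos_add, sin_add] <;> ring

/-- The second difference in `count` annihilates the cosine in `step`. Only at `j = 0` does the
neighbour `-1` obey `step` with the opposite sign, and this adds one tile. -/
lemma count_step (N : IsNecklace h r α s n) {j : ℤ} (h0 : 0 ≤ j) (h1 : j + 1 < h) :
    n (j + r) = n j + if j = 0 then 1 else 0 := by
  have hc := N.cos_pos.ne'
  have e1 := N.step (j + 1) (by lia) (by lia)
  have e2 := N.step j h0 (by lia)
  have c1 := N.count j
  have c2 := N.count (j + r)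
  rw [show j + r + 1 = j + 1 + r by ring, show j + r - 1 = j - 1 + r by ring, e1, e2] at c2
  have e3 : s (j - 1 + r) = s (j - 1) - cos ((2 * (j - 1 : ℤ) + 1) * α) +
      (if j = 0 then 2 * cos α else 0) := by
    split_ifs with hj
    · subst hj
      have := N.step (h - 1) (by lia) (by lia)
      rw [show (h : ℤ) - 1 + r = r - 1 + h by ring, show (h : ℤ) - 1 = -1 + h by ring, N.periodic,
        N.periodic, N.angle_add, cos_add_pi] at this
      rw [show (0 : ℤ) - 1 + r = r - 1 by ring, this]; norm_num; ring
    · rw [N.step (j - 1) (by lia) (by lia), add_zero]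
  rw [e3, show (2 * ((j + 1 : ℤ) : ℝ) + 1) * α = (2 * j + 1) * α + 2 * α by push_cast; ring,
    show (2 * ((j - 1 : ℤ) : ℝ) + 1) * α = (2 * j + 1) * α - 2 * α by push_cast; ring,
    cos_add, cos_sub] at c2
  have : 2 * cos α * (n (j + r) : ℝ) = 2 * cos α * ((n j + if j = 0 then 1 else 0 : ℤ) : ℝ) := by
    rw [← c2]; push_cast; rw [mul_add, ← c1]; split_ifs <;> ring
  exact_mod_cast mul_left_cancel₀ (by simpa using hc) this

lemma count_step_last (N : IsNecklace h r α s n) : n (h - 1 + r) = n (h - 1) - 1 := by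
  have hc := N.cos_pos.ne'
  have hh := N.two_le
  have e1 := N.step (h - 2) (by lia) (by lia)
  have e2 := N.step (h - 1) (by lia) (by lia)
  have e3 := N.step 0 (by lia) (by lia)
  have c1 := N.count (h - 1)
  have c2 := N.count (h - 1 + r)
  rw [show (h : ℤ) - 1 + r + 1 = 0 + r + h by ring, show (h : ℤ) - 1 + r - 1 = h - 2 + r by ring,
    N.periodic, e1, e2, e3] at c2
  rw [show (h : ℤ) - 1 + 1 = 0 + h by ring, N.periodic, show (h : ℤ) - 1 - 1 = h - 2 by ring] at c1
  have a1 : (2 * ((h - 2 : ℤ) : ℝ) + 1) * α = π - 3 * α := by rw [← N.angle]; push_cast; ring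
  have a2 : (2 * ((h - 1 : ℤ) : ℝ) + 1) * α = π - α := by rw [← N.angle]; push_cast; ring
  rw [a1, a2, cos_pi_sub, cos_pi_sub, show (2 * ((0 : ℤ) : ℝ) + 1) * α = α by simp,
    show 3 * α = 2 * α + α by ring, cos_add] at c2
  have c3 : sin (2 * α) * sin α = cos α - cos (2 * α) * cos α := by
    rw [sin_two_mul, cos_two_mul, show 2 * sin α * cos α * sin α = 2 * cos α * sin α ^ 2 by ring,
      sin_sq]; ring
  have : 2 * cos α * (n (h - 1 + r) : ℝ) = 2 * cos α * ((n (h - 1) - 1 : ℤ) : ℝ) := by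
    rw [← c2]; push_cast; linear_combination c1 - c3
  exact_mod_cast mul_left_cancel₀ (by simpa using hc) this

end IsNecklace

/-! ### Forward invariance of the necklace region off the axis -/

namespace IsNecklace

variable {h : ℕ} {r : ℤ} {α : ℝ} {s : ℤ → ℝ} {n : ℤ → ℤ}

lemma corner_eq_bead (α : ℝ) (s : ℤ → ℝ) (j : ℤ) : bead α s j 0 = corner α s j := by
  unfold bead; apply Complex.ext <;> simp

lemma im_corner_zero (N : IsNecklace h r α s n) :
    (corner α s 0).im = cos α / (2 * sin α) := by
  unfold corner
  simp [← N.start]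

/-- The tiles on the sides in the upper half-plane do not cross the real axis. -/
lemma le_im_bead (N : IsNecklace h r α s n) {j k : ℤ} (h0 : 0 ≤ j) (h1 : j < h)
    (k0 : 0 ≤ k) (k1 : k < n j) : cos α / (2 * sin α) ≤ (bead α s j k).im := by
  have hs := N.sin_pos
  have hc := N.cos_pos
  have k0' : (0 : ℝ) ≤ k := by exact_mod_cast k0
  have k1' : (k : ℝ) + 1 ≤ n j := by exact_mod_cast k1
  have e1 : (bead α s j k).im =
      (corner α s j).im + k * (cos ((2 * j + 1) * α) / sin α) := by
    unfold bead; simp [mul_div_assoc]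
  have e2 : (corner α s (j + 1)).im =
      (corner α s j).im + n j * (cos ((2 * j + 1) * α) / sin α) := by
    rw [← corner_eq_bead, ← N.bead_count]; unfold bead; simp [mul_div_assoc]
  rw [e1]
  have hj : cos α / (2 * sin α) ≤ (corner α s j).im := by
    rcases eq_or_lt_of_le h0 with rfl | hj
    · exact N.im_corner_zero.ge
    · exact N.height j hj h1
  by_cases hl : j + 1 < h
  · have hj1 := N.height (j + 1) (by lia) hl
    generalize cos ((2 * (j : ℝ) + 1) * α) / sin α = d at *
    rcases le_total 0 d with hd | hd
    · nlinarith
    · nlinarith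
  -- The last side ends at corner `h`, below the axis by one apothem. Each tile descends by two
  -- apothems, so the last one, `k = n j - 1`, still rests on the axis.
  · obtain rfl : j = h - 1 := by lia
    have e3 : (2 * (((h : ℤ) - 1 : ℤ) : ℝ) + 1) * α = π - α := by
      rw [← N.angle]; push_cast; ring
    rw [show (h : ℤ) - 1 + 1 = 0 + h by ring, N.corner_add, Complex.neg_im, N.im_corner_zero] at e2
    rw [e3, cos_pi_sub] at e2 ⊢
    have hd : 0 < cos α / sin α := by positivity
    rw [show cos α / (2 * sin α) = cos α / sin α / 2 by field_simp, neg_div] at *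
    generalize cos α / sin α = d at *
    nlinarith

lemma neg_mem_tile {w z : ℂ} (hz : z ∈ tile α w) : -z ∈ tile α (-w) := by
  intro k
  have := hz k
  rw [← abs_neg, ← Complex.neg_im, ← mul_neg, neg_sub] at this
  rw [show -z - -w = w - z by ring]
  exact this

lemma neg_mem (N : IsNecklace h r α s n) {z : ℂ} (hz : z ∈ necklaceRegion α s n) :
    -z ∈ necklaceRegion α s n := by
  rcases hz with hz | ⟨j, k, k0, k1, hz⟩
  · left
    intro j
    have := hz (j + h)
    rw [N.periodic, N.angle_add, cos_add_pi, sin_add_pi] at this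
    simpa using this
  · right
    refine ⟨j + h, k, k0, by rwa [N.count_periodic], ?_⟩
    rw [N.bead_add]
    exact neg_mem_tile hz

/-- The centre of a tile, up to sign, lies on a side in the upper half-plane. -/
lemma bead_rep (N : IsNecklace h r α s n) (j k : ℤ) : ∃ i : ℤ, 0 ≤ i ∧ i < h ∧ n i = n j ∧
    (bead α s j k = bead α s i k ∨ bead α s j k = -bead α s i k) := by
  obtain ⟨i, m, h0, h1, rfl⟩ := N.exists_rep j
  refine ⟨i, h0, h1, ((N.count_periodic.int_mul m) i).symm, ?_⟩
  induction m using Int.induction_on with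
  | zero => simp
  | succ m ih =>
    rw [add_mul, one_mul, ← add_assoc, N.bead_add]
    rcases ih with ih | ih <;> simp [ih]
  | pred m ih =>
    have := N.bead_add (i + (-(m : ℤ) - 1) * h) k
    rw [show i + (-(m : ℤ) - 1) * h + h = i + -(m : ℤ) * h by ring] at this
    rw [this] at ih
    rcases ih with ih | ih
    · right; rw [← ih, neg_neg]
    · left; exact neg_injective ih

lemma tile_step {w z : ℂ} (r : ℤ) (hz : z ∈ tile α w) :
    dir (2 * r * α) * (z - 1) ∈ tile α (dir (2 * r * α) * (w - 1)) := by
  intro k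
  have := hz (k + r)
  rw [← mul_sub, ← mul_assoc, dir_mul_dir, sub_sub_sub_cancel_right]
  rwa [show 2 * ((k + r : ℤ) : ℝ) * α = 2 * k * α + 2 * r * α by push_cast; ring] at this

lemma step_mem_of_mem_tile (N : IsNecklace h r α s n) {z : ℂ} (him : 0 < z.im) {j k : ℤ}
    (k0 : 0 ≤ k) (k1 : k < n j) (hz : z ∈ tile α (bead α s j k)) :
    dir (2 * r * α) * (z - 1) ∈ necklaceRegion α s n := by
  obtain ⟨i, h0, h1, hn, hb⟩ := N.bead_rep j k
  rw [← hn] at k1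
  have hh := N.le_im_bead h0 h1 k0 k1
  rcases hb with hb | hb
  · rw [hb] at hz
    have ht := tile_step r hz
    rw [N.bead_step h0 h1] at ht
    by_cases hl : k + (if i = 0 then 1 else 0) < n (i + r)
    · exact Or.inr ⟨_, _, by split_ifs <;> lia, hl, ht⟩
    -- Only the last upper side loses a tile; its final tile becomes the first one on the next side.
    · have hi : i = h - 1 := by
        by_contra hne
        have := N.count_step h0 (by lia)
        lia
      have h2 := N.two_le
      have hc : k + (if i = 0 then 1 else 0) = n (i + r) := by
        have := N.count_step_last
        rw [← hi] at this
        rw [if_neg (by lia)] at *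
        lia
      rw [hc, N.bead_count] at ht
      exact Or.inr ⟨_, _, le_rfl, N.count_pos _, ht⟩
  · exfalso
    have := hz 0
    rw [hb] at this
    simp [dir] at this
    have := (abs_le.1 this).2
    linarith

/-- The hypotheses describe the triangle spanned by the centre of the tile and its bottom side. -/
lemma triangle_mem_tile (N : IsNecklace h r α s n) {u w : ℂ}
    (hx : cos α * |u.re - w.re| ≤ sin α * (w.im - u.im))
    (hy : w.im - u.im ≤ cos α / (2 * sin α)) : u ∈ tile α w := by
  intro k
  refine le_trans ?_ hy
  have hs := N.sin_pos
  have hc := N.cos_pos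
  have hY : 0 ≤ w.im - u.im := by
    have : 0 ≤ cos α * |u.re - w.re| := by positivity
    nlinarith
  have h1 : |cos (2 * k * α - α)| ≤ cos α := by
    have := N.abs_cos_le (k - 1)
    rwa [show (2 * ((k - 1 : ℤ) : ℝ) + 1) * α = 2 * k * α - α by push_cast; ring] at this
  have h2 : |cos (2 * k * α + α)| ≤ cos α := by
    have := N.abs_cos_le k
    rwa [show (2 * (k : ℝ) + 1) * α = 2 * k * α + α by ring] at this
  simp only [Complex.mul_im, dir_re, dir_im, Complex.sub_re, Complex.sub_im]
  generalize 2 * (k : ℝ) * α = θ at *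
  rw [cos_sub, abs_le] at h1
  rw [cos_add, abs_le] at h2
  have hm : |cos θ| * cos α + |sin θ| * sin α ≤ cos α := by
    rcases abs_cases (cos θ) with ⟨e1, -⟩ | ⟨e1, -⟩ <;>
      rcases abs_cases (sin θ) with ⟨e2, -⟩ | ⟨e2, -⟩ <;> rw [e1, e2] <;> linarith
  refine le_of_mul_le_mul_left ?_ hc
  calc cos α * |cos θ * (u.im - w.im) + sin θ * (u.re - w.re)|
      ≤ cos α * (|cos θ| * (w.im - u.im) + |sin θ| * |u.re - w.re|) := by
        gcongr
        refine (abs_add_le _ _).trans_eq ?_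
        rw [abs_mul, abs_mul, abs_sub_comm u.im, abs_of_nonneg hY]
    _ = |cos θ| * cos α * (w.im - u.im) + |sin θ| * (cos α * |u.re - w.re|) := by ring
    _ ≤ |cos θ| * cos α * (w.im - u.im) + |sin θ| * (sin α * (w.im - u.im)) := by gcongr
    _ = (|cos θ| * cos α + |sin θ| * sin α) * (w.im - u.im) := by ring
    _ ≤ cos α * (w.im - u.im) := by gcongr

lemma step_mem_of_mem_polygon (N : IsNecklace h r α s n) {z : ℂ} (him : 0 < z.im)
    (hz : z ∈ polygon α s) : dir (2 * r * α) * (z - 1) ∈ necklaceRegion α s n := by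
  have hs := N.sin_pos
  have hc := N.cos_pos
  have hh := N.two_le
  -- The image satisfies the constraints coming from the upper half-plane.
  have upper : ∀ j : ℤ, 0 ≤ j → j < h →
      (z.re - 1) * cos ((2 * j + 1) * α) + z.im * sin ((2 * j + 1) * α) ≤ s (j + r) := by
    intro j h0 h1
    rw [N.step j h0 h1]
    linarith [hz j]
  have u0 : (z.re - 1) * cos α + z.im * sin α ≤ s r := by simpa using upper 0 le_rfl (by lia)
  have hlast : (2 * ((h - 1 : ℤ) : ℝ) + 1) * α = π - α := by rw [← N.angle]; push_cast; ring
  have u1 : -((z.re - 1) * cos α) + z.im * sin α ≤ s (h - 1 + r) := by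
    have := upper (h - 1) (by lia) (by lia)
    rw [hlast, cos_pi_sub, sin_pi_sub] at this
    linarith
  have hr0 : s r = s 0 - cos α := by simpa using N.step 0 le_rfl (by lia)
  have hr1 : s (h - 1 + r) = s r + cos α := by
    rw [N.step (h - 1) (by lia) (by lia), hlast, cos_pi_sub, hr0, show (h : ℤ) - 1 = -1 + h by ring,
      N.periodic, ← N.start]
    ring
  -- By symmetry the remaining constraints are opposite to the upper ones, and only the one opposite
  -- to `j = 0` can fail, because `s (h - 1 + r)` exceeds `s r` by `cos α`. Where it fails, `z - 1`
  -- lies in a triangle with unit base on the axis and base angles given by the two extreme sides: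
  -- the one joining a tile's bottom side to its centre.
  by_cases hlow : -((z.re - 1) * cos α + z.im * sin α) ≤ s r
  · left
    have main : ∀ j : ℤ, 0 ≤ j → j < h →
        |(z.re - 1) * cos ((2 * j + 1) * α) + z.im * sin ((2 * j + 1) * α)| ≤ s (j + r) := by
      intro j h0 h1
      refine abs_le.2 ⟨?_, upper j h0 h1⟩
      rcases eq_or_lt_of_le h0 with rfl | hj
      · simp; linarith
      by_cases hl : j + 1 < h
      · have hm := N.abs_cos_middle_le (i := j) (by lia) hl
        have hsj : 0 ≤ sin ((2 * j + 1) * α) := by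
          have := N.angle_mem h0 h1
          exact sin_nonneg_of_nonneg_of_le_pi (by linarith [N.angle_pos]) (by linarith [N.angle_pos])
        have hsz : 0 ≤ z.im * sin ((2 * j + 1) * α) := by positivity
        have hsz' : 0 ≤ z.im * sin α := by positivity
        have hX : cos α * |z.re - 1| ≤ s (h - 1 + r) := by
          rcases abs_cases (z.re - 1) with ⟨e, -⟩ | ⟨e, -⟩ <;> rw [e] <;> linarith
        have h3 : cos α * ((z.re - 1) * -cos ((2 * j + 1) * α)) ≤ cos α * s (j + r) :=
          calc cos α * ((z.re - 1) * -cos ((2 * j + 1) * α))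
              ≤ cos α * (|z.re - 1| * |cos ((2 * j + 1) * α)|) := by
                rw [← abs_neg (cos _), ← abs_mul]; gcongr; exact le_abs_self _
            _ = |cos ((2 * j + 1) * α)| * (cos α * |z.re - 1|) := by ring
            _ ≤ cos (3 * α) * s (h - 1 + r) := by
                gcongr
                exact (abs_nonneg _).trans hm
            _ ≤ cos α * s (j + r) := N.large _ _
        have := le_of_mul_le_mul_left h3 hc
        linarith
      · obtain rfl : j = h - 1 := by lia
        rw [hlast, cos_pi_sub, sin_pi_sub]
        have : 0 ≤ z.im * sin α := by positivity
        linarith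
    intro j
    obtain ⟨i, m, h0, h1, hj⟩ := N.exists_rep (j - r)
    obtain rfl : j = i + r + m * h := by lia
    have hper : s (i + r + m * h) = s (i + r) := N.periodic.int_mul m (i + r)
    rw [hper]
    refine le_trans (le_trans (le_abs_self _) (le_of_eq ?_)) (main i h0 h1)
    have e : (2 * ((i + r + m * h : ℤ) : ℝ) + 1) * α =
        2 * r * α + (2 * i + 1) * α + m * π := by
      rw [← N.angle]; push_cast; ring
    have e2 : ∀ c : ℝ, |c| = |(-1 : ℝ) ^ m * c| := fun c ↦ by
      rw [abs_mul, abs_zpow, abs_neg, abs_one, one_zpow, one_mul]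
    rw [e, cos_add_int_mul_pi, sin_add_int_mul_pi, e2 (_ + z.im * _)]
    congr 1
    simp only [Complex.mul_re, Complex.mul_im, dir_re, dir_im, cos_add, sin_add, Complex.sub_re,
      Complex.sub_im, Complex.one_re, Complex.one_im]
    linear_combination (-1 : ℝ) ^ m * ((z.re - 1) * cos ((2 * i + 1) * α) +
      z.im * sin ((2 * i + 1) * α)) * sin_sq_add_cos_sq (2 * r * α)
  · right
    push Not at hlow
    refine ⟨h + r, 0, le_rfl, N.count_pos _, ?_⟩
    -- The tile in question is the image of a tile centred at `w`.
    set w : ℂ := ⟨-(s (h - 1 + r) + s r) / (2 * cos α), cos α / (2 * sin α)⟩ with hw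
    have hcorner : bead α s (h + r) 0 = dir (2 * r * α) * w := by
      rw [corner_eq_bead, add_comm, N.corner_add]
      unfold corner
      rw [show r - 1 = h - 1 + r - h by ring, N.periodic.sub_eq, hr1, hw]
      rw [← mul_neg]
      congr 1
      apply Complex.ext <;> simp [hr1] <;> ring
    rw [hcorner]
    intro k
    have ht : z - 1 ∈ tile α w := by
      apply N.triangle_mem_tile
      · simp only [hw, Complex.sub_re, Complex.one_re, Complex.sub_im, Complex.one_im, sub_zero]
        have e : cos α * |z.re - 1 - -(s (h - 1 + r) + s r) / (2 * cos α)| =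
            |cos α * (z.re - 1) + (s (h - 1 + r) + s r) / 2| := by
          rw [← abs_of_pos hc, ← abs_mul, abs_of_pos hc]; congr 1; field_simp; ring
        have e' : sin α * (cos α / (2 * sin α) - z.im) = cos α / 2 - sin α * z.im := by
          field_simp
        rw [e, e', abs_le]
        constructor <;> linarith
      · simp [hw, him.le]
    have := ht (k + r)
    rwa [← mul_sub, ← mul_assoc, dir_mul_dir,
      ← show 2 * ((k + r : ℤ) : ℝ) * α = 2 * k * α + 2 * r * α by push_cast; ring]

lemma step_mem (N : IsNecklace h r α s n) {z : ℂ} (him : z.im ≠ 0)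
    (hz : z ∈ necklaceRegion α s n) : F (dir (2 * r * α)) z ∈ necklaceRegion α s n := by
  have upper : ∀ z ∈ necklaceRegion α s n, 0 < z.im →
      dir (2 * r * α) * (z - 1) ∈ necklaceRegion α s n := by
    rintro z (hz | ⟨j, k, k0, k1, hz⟩) him
    · exact N.step_mem_of_mem_polygon him hz
    · exact N.step_mem_of_mem_tile him k0 k1 hz
  unfold F H
  rcases him.lt_or_gt with him | him
  · rw [if_neg him.not_ge]
    have := N.neg_mem (upper (-z) (N.neg_mem hz) (by simpa using him))
    convert this using 1
    ring
  · rw [if_pos him.le]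
    exact upper z hz him

end IsNecklace

/-! ### The cohomological equation and existence of necklaces -/

lemma abs_mul_le {c x C : ℝ} (hc : |c| ≤ 1) (hx : |x| ≤ C) : |c * x| ≤ C := by
  rw [abs_mul]
  exact (mul_le_of_le_one_left (abs_nonneg x) hc).trans hx

lemma eq_of_coprime_periods {β : Type*} {f : ℤ → β} {r h : ℤ} (hrh : IsCoprime r h)
    (hr : Function.Periodic f r) (hh : Function.Periodic f h) (j : ℤ) : f j = f 0 := by
  obtain ⟨a, b, hab⟩ := hrh
  have h1 : Function.Periodic f 1 := by
    rw [← hab]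
    exact (hr.int_mul a).add_period (hh.int_mul b)
  simpa using (h1.int_mul j) 0

/-- Translation by `r` is a single cycle on the residues mod `h`, so the only obstruction is the
total sum of `g`, which vanishes by the antisymmetry. The solution is minus the partial sum along
the cycle, the position of `j` being `j * a` with `a` inverse to `r`. -/
lemma exists_coboundary {h : ℕ} (hh : 0 < h) {r : ℤ} (hr : IsCoprime r h) {g : ℤ → ℝ}
    (hg : Function.Periodic g h) (hanti : ∀ j, g (-1 - j) = -g j) :
    ∃ σ : ℤ → ℝ, Function.Periodic σ h ∧ ∀ j, σ (j + r) = σ j - g j := by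
  have hz : (0 : ℤ) < h := by exact_mod_cast hh
  obtain ⟨a, b, hab⟩ := hr
  have hper : ∀ i m : ℤ, g (i + m * h) = g i := fun i m ↦ (hg.int_mul m) i
  have hrep : ∀ x : ℤ, ∃ m : ℕ, m < h ∧ x % h = m ∧ ∃ c, x = m + c * h := by
    intro x
    refine ⟨(x % h).toNat, ?_, ?_, x / h, ?_⟩
    · have := Int.emod_lt_of_pos x hz
      have := Int.emod_nonneg x hz.ne'
      lia
    · exact (Int.toNat_of_nonneg (Int.emod_nonneg x hz.ne')).symm
    · rw [Int.toNat_of_nonneg (Int.emod_nonneg x hz.ne'), mul_comm]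
      exact (Int.emod_add_mul_ediv x h).symm
  have hsum : ∑ i ∈ Finset.range h, g (i * r) = 0 := by
    have key : ∑ i ∈ Finset.range h, g (i * r) = ∑ i ∈ Finset.range h, -g (i * r) := by
      have hmap : ∀ i ∈ Finset.range h, ((-a - i : ℤ) % h).toNat ∈ Finset.range h := by
        intro i _
        obtain ⟨m, hm, e, -⟩ := hrep (-a - i)
        rw [e]; simpa using hm
      have hinv : ∀ i ∈ Finset.range h,
          ((-a - (((-a - i : ℤ) % h).toNat : ℤ)) % h).toNat = i := by
        intro i hi
        obtain ⟨m, hm, e, c, hc⟩ := hrep (-a - i)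
        rw [e, Int.toNat_natCast, show -a - (m : ℤ) = i + c * h by lia, Int.add_mul_emod_self_right,
          Int.emod_eq_of_lt (by lia) (by simpa using hi), Int.toNat_natCast]
      refine Finset.sum_nbij' (fun i ↦ ((-a - i : ℤ) % h).toNat)
        (fun i ↦ ((-a - i : ℤ) % h).toNat) hmap hmap hinv hinv ?_
      intro i _
      obtain ⟨m, hm, e, c, hc⟩ := hrep (-a - i)
      simp only [e, Int.toNat_natCast]
      rw [← hanti, ← hper (-1 - m * r) (c * -r + b)]
      congr 1
      linear_combination (-r) * hc - hab
    rw [Finset.sum_neg_distrib] at key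
    linarith
  refine ⟨fun j ↦ -∑ i ∈ Finset.range ((j * a) % h).toNat, g (i * r), fun j ↦ ?_, fun j ↦ ?_⟩
  · simp only
    rw [show (j + h) * a = j * a + a * h by ring, Int.add_mul_emod_self_right]
  · simp only
    obtain ⟨m, hm, e, c, hc⟩ := hrep (j * a)
    have hgj : g (m * r) = g j := by
      rw [← hper (m * r) (c * r + b * j)]
      congr 1
      linear_combination (-r) * hc + j * hab
    rw [e, Int.toNat_natCast,
      show (j + r) * a = (m + 1 : ℕ) + (c - b) * h by push_cast; linear_combination hc + hab,
      Int.add_mul_emod_self_right]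
    rcases eq_or_lt_of_le (Nat.succ_le_of_lt hm) with hm' | hm'
    · rw [← hm', Nat.succ_eq_add_one, Finset.sum_range_succ, hgj] at hsum
      rw [show m + 1 = h from hm', Int.emod_self]
      simp
      linarith
    · rw [Int.emod_eq_of_lt (by positivity) (by exact_mod_cast hm'), Int.toNat_natCast,
        Finset.sum_range_succ, hgj]
      ring

lemma exists_bound_of_periodic {h : ℕ} (hh : 0 < h) {σ : ℤ → ℝ} (hσ : Function.Periodic σ h) :
    ∃ C, 0 ≤ C ∧ ∀ j, |σ j| ≤ C := by
  refine ⟨∑ i ∈ Finset.range h, |σ i|, Finset.sum_nonneg fun _ _ ↦ abs_nonneg _, fun j ↦ ?_⟩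
  have hz : (0 : ℤ) < h := by exact_mod_cast hh
  have h1 : σ j = σ ((j % h).toNat : ℤ) := by
    rw [Int.toNat_of_nonneg (Int.emod_nonneg j hz.ne')]
    conv_lhs => rw [← Int.emod_add_mul_ediv j h, mul_comm]
    exact (hσ.int_mul (j / h)) _
  rw [h1]
  refine Finset.single_le_sum (f := fun i : ℕ ↦ |σ i|) (fun _ _ ↦ abs_nonneg _) ?_
  have := Int.emod_lt_of_pos j hz
  rw [Finset.mem_range]; lia

/-- The displacements of the sides of the polygon: a solution of the cohomological equation which
makes the deviations of the side lengths commensurable. -/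
lemma exists_displacement {h : ℕ} (hh : 2 ≤ h) {r : ℤ} (hr : IsCoprime r h) {α : ℝ}
    (hα : 2 * h * α = π) :
    ∃ (σ : ℤ → ℝ) (e : ℤ → ℤ), Function.Periodic σ h ∧
      (∀ j : ℤ, 0 ≤ j → j < h → σ (j + r) = σ j - cos ((2 * j + 1) * α)) ∧
      σ 0 - σ (-1) = cos α ∧
      ∀ j, σ (j + 1) + σ (j - 1) - 2 * cos (2 * α) * σ j =
        σ 1 + σ (-1) - 2 * cos (2 * α) * σ 0 + 2 * cos α * e j := by
  have hz : (0 : ℤ) < h := by lia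
  set g : ℤ → ℝ := fun j ↦ cos ((2 * (j % h : ℤ) + 1) * α) with hgdef
  have hg : Function.Periodic g h := fun j ↦ by simp [hgdef]
  have hgv : ∀ j : ℤ, 0 ≤ j → j < h → g j = cos ((2 * j + 1) * α) := fun j h0 h1 ↦ by
    simp only [hgdef]; rw [Int.emod_eq_of_lt h0 h1]
  have hanti : ∀ j, g (-1 - j) = -g j := by
    intro j
    have : (-1 - j) % (h : ℤ) = h - 1 - j % h := by
      have e : -1 - j = (h - 1 - j % h) + (-(j / h) - 1) * h := by
        have := Int.emod_add_mul_ediv j h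
        linear_combination this
      have := Int.emod_lt_of_pos j hz
      have := Int.emod_nonneg j hz.ne'
      rw [e, Int.add_mul_emod_self_right, Int.emod_eq_of_lt (by lia) (by lia)]
    simp only [hgdef]
    rw [this, ← cos_pi_sub, ← hα]
    congr 1; push_cast; ring
  have hg0 : g 0 = cos α := by rw [hgv 0 le_rfl hz]; simp
  have hgm : g (-1) = -cos α := by rw [← hg0, ← hanti]; simp
  have hgh : g h = cos α := by rw [← hg0, ← hg 0, zero_add]
  obtain ⟨σ, hσ, hstep⟩ := exists_coboundary (by lia : 0 < h) hr hg hanti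
  -- The defect `f` from reflection symmetry has periods `h` and `r`, hence is constant; since `f
  -- (-1) = -f 0`, it is zero.
  have hrefl : σ (-1) - σ 0 + g 0 = 0 := by
    set f : ℤ → ℝ := fun j ↦ σ (-1 - j) - σ j + g j with hf
    have hfh : Function.Periodic f h := fun j ↦ by
      simp only [hf]
      rw [hσ, hg, show -1 - (j + (h : ℤ)) = -1 - j - h by ring, hσ.sub_eq]
    have hfr : Function.Periodic f r := fun j ↦ by
      simp only [hf]
      have h1 := hstep (-1 - (j + r))
      rw [show -1 - (j + r) + r = -1 - j by ring, hanti] at h1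
      rw [hstep j]
      linarith
    have h1 := eq_of_coprime_periods hr hfr hfh (-1)
    simp only [hf] at h1
    norm_num at h1
    rw [hgm] at h1
    rw [hg0] at *
    linarith
  set d : ℤ → ℝ := fun j ↦ σ (j + 1) + σ (j - 1) - 2 * cos (2 * α) * σ j with hd
  have hdh : Function.Periodic d h := fun j ↦ by
    simp only [hd]
    rw [show j + (h : ℤ) + 1 = j + 1 + h by ring, show j + (h : ℤ) - 1 = j - 1 + h by ring,
      hσ, hσ, hσ]
  -- The operator kills the cosine, so only the seam contributes: continuing past `0` or `h - 1`,
  -- the `h`-periodic `g` has the opposite sign to the antiperiodic cosine.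
  have hD : ∀ j, ∃ e : ℤ, g (j + 1) + g (j - 1) - 2 * cos (2 * α) * g j = 2 * cos α * e := by
    have base : ∀ j : ℤ, 0 ≤ j → j < h →
        ∃ e : ℤ, g (j + 1) + g (j - 1) - 2 * cos (2 * α) * g j = 2 * cos α * e := by
      intro j h0 h1
      refine ⟨(if j + 1 = h then 1 else 0) - (if j = 0 then 1 else 0), ?_⟩
      have e1 : g (j + 1) = cos ((2 * j + 1) * α + 2 * α) +
          2 * cos α * (if j + 1 = h then 1 else 0) := by
        split_ifs with hl
        · rw [hl, hgh, show (2 * (j : ℝ) + 1) * α + 2 * α = α + π by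
            rw [← hα]; have : (j : ℝ) + 1 = h := by exact_mod_cast hl
            rw [← this]; ring, cos_add_pi]
          ring
        · rw [hgv _ (by lia) (by lia), mul_zero, add_zero]; congr 1; push_cast; ring
      have e2 : g (j - 1) = cos ((2 * j + 1) * α - 2 * α) -
          2 * cos α * (if j = 0 then 1 else 0) := by
        split_ifs with hl
        · rw [hl, zero_sub, hgm, show (2 * ((0 : ℤ) : ℝ) + 1) * α - 2 * α = -α by
            push_cast; ring, cos_neg]
          ring
        · rw [hgv _ (by lia) (by lia), mul_zero, sub_zero]; congr 1; push_cast; ring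
      rw [e1, e2, hgv j h0 h1, cos_add, cos_sub]
      push_cast
      ring
    intro j
    have hp : ∀ i : ℤ, g (i + j / h * h) = g i := fun i ↦ (hg.int_mul (j / h)) i
    obtain ⟨e, he⟩ := base (j % h) (Int.emod_nonneg j hz.ne') (Int.emod_lt_of_pos j hz)
    have hj := Int.emod_add_mul_ediv j h
    refine ⟨e, ?_⟩
    rw [← he, ← hp (j % h + 1), ← hp (j % h - 1), ← hp (j % h),
      show j % h + 1 + j / h * h = j + 1 by linear_combination hj,
      show j % h - 1 + j / h * h = j - 1 by linear_combination hj,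
      show j % h + j / h * h = j by linear_combination hj]
  -- Being congruent to `d 0` modulo `2 * cos α` is invariant under shifts by `r` and by `h`, hence
  -- under all shifts.
  have hP : ∀ j, ∃ e : ℤ, d j = d 0 + 2 * cos α * e := by
    set P : ℤ → Prop := fun j ↦ ∃ e : ℤ, d j = d 0 + 2 * cos α * e with hPdef
    have hPh : Function.Periodic P h := fun j ↦ by simp only [hPdef]; rw [hdh]
    have hPr : Function.Periodic P r := fun j ↦ by
      obtain ⟨c, hc⟩ := hD j
      have h1 : d (j + r) = d j - 2 * cos α * c := by
        simp only [hd]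
        rw [show j + r + 1 = j + 1 + r by ring, show j + r - 1 = j - 1 + r by ring, hstep, hstep,
          hstep, ← hc]
        ring
      refine propext ⟨fun ⟨e, he⟩ ↦ ⟨e + c, ?_⟩, fun ⟨e, he⟩ ↦ ⟨e - c, ?_⟩⟩
      · push_cast; linarith
      · push_cast; linarith
    intro j
    have := eq_of_coprime_periods hr hPr hPh j
    exact this.mpr ⟨0, by simp⟩
  choose e he using hP
  refine ⟨σ, e, hσ, fun j h0 h1 ↦ by rw [hstep, hgv j h0 h1], by linarith, fun j ↦ ?_⟩
  simpa [hd] using he j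

/-- Necklaces exist around every point. -/
lemma exists_isNecklace {h : ℕ} (hh : 2 ≤ h) {r : ℤ} (hr : IsCoprime r h) {α : ℝ}
    (hα : 2 * h * α = π) (z : ℂ) :
    ∃ s n, IsNecklace h r α s n ∧ z ∈ polygon α s := by
  have hh' : (2 : ℝ) ≤ h := by exact_mod_cast hh
  have hp := pi_pos
  have α0 : 0 < α := by by_contra! hc; nlinarith
  have α1 : 4 * α ≤ π := by nlinarith
  have hs : 0 < sin α := sin_pos_of_pos_of_lt_pi α0 (by linarith)
  have hc : 0 < cos α := cos_pos_of_mem_Ioo ⟨by linarith, by linarith⟩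
  have h2 : 0 < 1 - cos (2 * α) := by rw [cos_two_mul, cos_sq']; nlinarith
  have h3 : 0 < cos α - cos (3 * α) :=
    sub_pos.2 (cos_lt_cos_of_nonneg_of_le_pi α0.le (by linarith) (by linarith))
  obtain ⟨σ, e, hσ, hstep, hstart, hcount⟩ := exists_displacement hh hr hα
  obtain ⟨C, C0, hC⟩ := exists_bound_of_periodic (by lia : 0 < h) hσ
  set d := σ 1 + σ (-1) - 2 * cos (2 * α) * σ 0 with hd
  have ev : ∀ A B : ℝ, 0 < A → ∀ᶠ S in Filter.atTop, B ≤ A * S := fun A B hA ↦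
    (Filter.tendsto_id.const_mul_atTop hA).eventually_ge_atTop B
  -- The five bounds give, in order, `pos`, `count_pos`, `large`, `height` and membership of `z`.
  obtain ⟨M, hM⟩ := Filter.eventually_atTop.1
    ((ev 1 (C + 1) one_pos).and <| (ev _ (2 * C + 1) h2).and <| (ev _ (2 * C) h3).and <|
      (ev _ (2 * sin α * C + (C / sin α + cos α / (2 * sin α))) (by positivity : 0 < 2 * sin α)).and
      (ev 1 (C + 2 * ‖z‖) one_pos))
  obtain ⟨N, hN⟩ := exists_nat_ge ((M * (2 * (1 - cos (2 * α))) + d) / (2 * cos α))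
  -- Adding a constant `S` to `σ` preserves `step` and `start`. This value makes the common part of
  -- the side lengths correspond to the integer `N`, so every count is `N + e j`.
  set S := (2 * cos α * N - d) / (2 * (1 - cos (2 * α))) with hS
  have hMS : M ≤ S := by
    rw [hS, le_div_iff₀ (by positivity)]
    rw [div_le_iff₀ (by positivity)] at hN
    linarith
  have hSd : 2 * S * (1 - cos (2 * α)) + d = 2 * cos α * N := by
    rw [hS]; field_simp; ring
  obtain ⟨b1, b2, b3, b4, b5⟩ := hM S hMS
  have hlow : ∀ j, -C ≤ σ j := fun j ↦ (abs_le.1 (hC j)).1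
  have hupp : ∀ j, σ j ≤ C := fun j ↦ (abs_le.1 (hC j)).2
  have hcnt : ∀ j, S + σ (j + 1) + (S + σ (j - 1)) - 2 * cos (2 * α) * (S + σ j) =
      2 * cos α * ((N + e j : ℤ) : ℝ) := fun j ↦ by
    push_cast; linear_combination hcount j + hSd
  refine ⟨fun j ↦ S + σ j, fun j ↦ N + e j, ⟨hh, hα, fun j ↦ by simp [hσ j], ?_, ?_, hcnt, ?_, ?_,
    fun j ↦ by linarith [hlow j], ?_⟩, ?_⟩
  · intro j h0 h1
    linarith [hstep j h0 h1]
  · linarith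
  · intro j
    have h5 : 0 < 2 * cos α * ((N + e j : ℤ) : ℝ) := by
      rw [← hcnt j]
      have := abs_le.1 (abs_cos_le_one (2 * α))
      have : cos (2 * α) * σ j ≤ C :=
        (le_abs_self _).trans (abs_mul_le (abs_cos_le_one _) (hC j))
      linarith [hlow (j + 1), hlow (j - 1)]
    exact_mod_cast pos_of_mul_pos_right h5 (by positivity)
  · intro j k
    have e1 : cos (3 * α) * σ j ≤ C := (le_abs_self _).trans (abs_mul_le (abs_cos_le_one _) (hC j))
    have e2 : -C ≤ cos α * σ k := (abs_le.1 (abs_mul_le (abs_cos_le_one α) (hC k))).1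
    linarith
  · intro j h0 h1
    have a0 : (1 : ℝ) ≤ j := by exact_mod_cast h0
    have a1 : (j : ℝ) + 1 ≤ h := by exact_mod_cast h1
    have hsin : sin (2 * α) ≤ sin (2 * j * α) := by
      have i1 : 2 * α ≤ 2 * j * α := by nlinarith
      have i2 : 2 * j * α ≤ π - 2 * α := by rw [← hα]; nlinarith
      rcases le_total (2 * j * α) (π / 2) with hl | hl
      · exact sin_le_sin_of_le_of_le_pi_div_two (by linarith) hl i1
      · rw [← sin_pi_sub (2 * j * α)]
        exact sin_le_sin_of_le_of_le_pi_div_two (by linarith) (by linarith) (by linarith)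
    have him : (corner α (fun j ↦ S + σ j) j).im =
        sin (2 * j * α) * ((2 * S + σ j + σ (j - 1)) / (2 * cos α)) +
          cos (2 * j * α) * ((σ j - σ (j - 1)) / (2 * sin α)) := by
      unfold corner; simp; ring
    rw [him]
    have t1 : 2 * sin α * (S - C) ≤
        sin (2 * j * α) * ((2 * S + σ j + σ (j - 1)) / (2 * cos α)) := by
      calc 2 * sin α * (S - C) = sin (2 * α) * ((2 * S - C - C) / (2 * cos α)) := by
            rw [sin_two_mul]; field_simp; ring
        _ ≤ _ := by
            gcongr
            · exact div_nonneg (by linarith) (by positivity)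
            · exact (sin_nonneg_of_nonneg_of_le_pi (by positivity) (by linarith)).trans hsin
            linarith [hlow j, hlow (j - 1)]
    have t2 : |cos (2 * j * α) * ((σ j - σ (j - 1)) / (2 * sin α))| ≤ C / sin α := by
      refine abs_mul_le (abs_cos_le_one _) ?_
      rw [abs_div, abs_of_pos (by positivity : 0 < 2 * sin α), div_le_div_iff₀ (by positivity) hs]
      have : |σ j - σ (j - 1)| ≤ 2 * C := abs_le.2
        ⟨by linarith [hlow j, hupp (j - 1)], by linarith [hupp j, hlow (j - 1)]⟩
      nlinarith
    linarith [(abs_le.1 t2).1]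
  · intro j
    have e1 : z.re * cos ((2 * j + 1) * α) ≤ ‖z‖ := (le_abs_self _).trans (by
      rw [mul_comm]; exact abs_mul_le (abs_cos_le_one _) (Complex.abs_re_le_norm z))
    have e2 : z.im * sin ((2 * j + 1) * α) ≤ ‖z‖ := (le_abs_self _).trans (by
      rw [mul_comm]; exact abs_mul_le (abs_sin_le_one _) (Complex.abs_im_le_norm z))
    linarith [hlow j]

/-! ### Boundedness of noncritical orbits -/

lemma IsNecklace.exists_norm_le {h : ℕ} {r : ℤ} {α : ℝ} {s : ℤ → ℝ} {n : ℤ → ℤ}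
    (N : IsNecklace h r α s n) : ∃ R, ∀ z ∈ necklaceRegion α s n, ‖z‖ ≤ R := by
  have hs := N.sin_pos
  have hc := N.cos_pos
  have hs2 := N.sin_two_pos
  set Q := ∑ j ∈ Finset.Ico 0 (h : ℤ), ∑ k ∈ Finset.Ico 0 (n j), ‖bead α s j k‖ with hQ
  have hbead : ∀ j k, 0 ≤ k → k < n j → ‖bead α s j k‖ ≤ Q := by
    intro j k k0 k1
    obtain ⟨i, h0, h1, hn, hb⟩ := N.bead_rep j k
    have e : ‖bead α s j k‖ = ‖bead α s i k‖ := by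
      rcases hb with hb | hb <;> rw [hb]
      rw [norm_neg]
    rw [e]
    calc ‖bead α s i k‖ ≤ ∑ k ∈ Finset.Ico 0 (n i), ‖bead α s i k‖ :=
          Finset.single_le_sum (f := fun k ↦ ‖bead α s i k‖) (fun _ _ ↦ norm_nonneg _)
            (Finset.mem_Ico.2 ⟨k0, by lia⟩)
      _ ≤ Q := Finset.single_le_sum (f := fun j ↦ ∑ k ∈ Finset.Ico 0 (n j), ‖bead α s j k‖)
            (fun _ _ ↦ Finset.sum_nonneg fun _ _ ↦ norm_nonneg _) (Finset.mem_Ico.2 ⟨h0, h1⟩)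
  have htile : ∀ z w, z ∈ tile α w →
      ‖z - w‖ ≤ cos α / sin α / sin (2 * α) + cos α / (2 * sin α) := by
    intro z w hz
    have t0 := hz 0
    have t1 := hz 1
    simp only [Int.cast_zero, Int.cast_one, mul_zero, zero_mul, mul_one, Complex.mul_im, dir_re,
      dir_im, cos_zero, sin_zero, one_mul, add_zero] at t0 t1
    refine (Complex.norm_le_abs_re_add_abs_im _).trans (add_le_add ?_ t0)
    rw [le_div_iff₀ hs2]
    have e : |(z - w).re| * sin (2 * α) =
        |(cos (2 * α) * (z - w).im + sin (2 * α) * (z - w).re) + -(cos (2 * α) * (z - w).im)| := by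
      rw [← abs_of_pos hs2, ← abs_mul, abs_of_pos hs2]; congr 1; ring
    rw [e]
    refine (abs_add_le _ _).trans ?_
    rw [abs_neg]
    have t2 := abs_mul_le (abs_cos_le_one (2 * α)) t0
    have e2 : cos α / sin α = cos α / (2 * sin α) + cos α / (2 * sin α) := by field_simp; ring
    rw [e2]
    exact add_le_add t1 t2
  refine ⟨max ((s 0 + s (-1)) / (2 * cos α) + (s 0 + s (-1)) / (2 * sin α))
    (cos α / sin α / sin (2 * α) + cos α / (2 * sin α) + Q), ?_⟩
  rintro z (hz | ⟨j, k, k0, k1, hz⟩)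
  · refine le_max_of_le_left ((Complex.norm_le_abs_re_add_abs_im z).trans ?_)
    have p1 := hz 0
    have p2 := hz (-1)
    have p3 := hz (0 + h)
    have p4 := hz (-1 + h)
    rw [N.angle_add, cos_add_pi, sin_add_pi, N.periodic] at p3 p4
    have e : (2 * ((-1 : ℤ) : ℝ) + 1) * α = -α := by push_cast; ring
    rw [e, cos_neg, sin_neg] at p2 p4
    simp only [Int.cast_zero, mul_zero, zero_add, one_mul] at p1 p3
    refine add_le_add ?_ ?_
    · rw [le_div_iff₀ (by positivity)]
      rcases abs_cases z.re with ⟨e, -⟩ | ⟨e, -⟩ <;> rw [e] <;> linarith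
    · rw [le_div_iff₀ (by positivity)]
      rcases abs_cases z.im with ⟨e, -⟩ | ⟨e, -⟩ <;> rw [e] <;> linarith
  · refine le_max_of_le_right ?_
    calc ‖z‖ = ‖(z - bead α s j k) + bead α s j k‖ := by rw [sub_add_cancel]
      _ ≤ _ := (norm_add_le _ _).trans (add_le_add (htile _ _ hz) (hbead j k k0 k1))

/-- Orbits that avoid the discontinuity line are bounded. -/
lemma exists_norm_iterate_le {h : ℕ} (hh : 2 ≤ h) {r : ℤ} (hr : IsCoprime r h) {α : ℝ}
    (hα : 2 * h * α = π) {z : ℂ} (hz : z ∉ criticalSet (dir (2 * r * α))) :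
    ∃ R, ∀ m, ‖(F (dir (2 * r * α)))^[m] z‖ ≤ R := by
  obtain ⟨s, n, N, hzp⟩ := exists_isNecklace hh hr hα z
  obtain ⟨R, hR⟩ := N.exists_norm_le
  refine ⟨R, fun m ↦ hR _ ?_⟩
  induction m with
  | zero => exact Or.inl hzp
  | succ m ih =>
    rw [Function.iterate_succ_apply']
    exact N.step_mem (fun h0 ↦ hz ⟨m, h0⟩) ih

/-! ### Discs off the critical set and periodicity -/

section General

variable {lam : ℂ}

lemma F_injective (hl : lam ≠ 0) : Function.Injective (F lam) := by
  intro z w hzw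
  have h1 : z - H z = w - H w := mul_left_cancel₀ hl hzw
  have him : z.im = w.im := by
    have := congrArg Complex.im h1
    unfold H at this
    split_ifs at this <;> simpa using this
  have hH : H z = H w := by unfold H; rw [him]
  rw [hH] at h1
  exact sub_left_injective h1

lemma H_eq_of_norm_lt {a b : ℂ} (hab : ‖a - b‖ < |b.im|) : a.im ≠ 0 ∧ H a = H b := by
  have h1 := (Complex.abs_im_le_norm (a - b)).trans_lt hab
  rw [Complex.sub_im, abs_lt] at h1
  unfold H
  rcases abs_cases b.im with ⟨e, hb⟩ | ⟨e, hb⟩ <;> rw [e] at h1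
  · have : 0 < a.im := by linarith
    exact ⟨this.ne', by rw [if_pos this.le, if_pos hb]⟩
  · have : a.im < 0 := by linarith
    exact ⟨this.ne, by rw [if_neg this.not_ge, if_neg hb.not_ge]⟩

lemma H_eq_of_segment {a b : ℂ} (hab : ∀ t ∈ Set.Icc (0 : ℝ) 1, (a + t * (b - a)).im ≠ 0) :
    H a = H b := by
  have hcont : ContinuousOn (fun t : ℝ ↦ (a + t * (b - a)).im) (Set.Icc 0 1) := by fun_prop
  have e0 : (a + ((0 : ℝ) : ℂ) * (b - a)).im = a.im := by simp
  have e1 : (a + ((1 : ℝ) : ℂ) * (b - a)).im = b.im := by simp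
  unfold H
  by_cases ha : 0 ≤ a.im <;> by_cases hb : 0 ≤ b.im
  · rw [if_pos ha, if_pos hb]
  · exfalso
    obtain ⟨t, ht, h0⟩ := intermediate_value_Icc' zero_le_one hcont
      (show (0 : ℝ) ∈ _ by rw [e0, e1]; exact ⟨(not_le.1 hb).le, ha⟩)
    exact hab t ht h0
  · exfalso
    obtain ⟨t, ht, h0⟩ := intermediate_value_Icc zero_le_one hcont
      (show (0 : ℝ) ∈ _ by rw [e0, e1]; exact ⟨(not_le.1 ha).le, hb⟩)
    exact hab t ht h0
  · rw [if_neg ha, if_neg hb]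

lemma F_sub_F {a b : ℂ} (hab : H a = H b) : F lam a - F lam b = lam * (a - b) := by
  unfold F; rw [hab]; ring

/-- A periodic point off the critical set is not in the closure of the critical set. -/
lemma isAperiodic_of_mem_closure (hl : ‖lam‖ = 1) {z : ℂ} (hz : z ∈ closure (criticalSet lam))
    (hz' : z ∉ criticalSet lam) : IsAperiodic (F lam) z := by
  rintro ⟨n, hn, hper⟩
  obtain ⟨k, -, hk⟩ := Finset.exists_min_image (Finset.range n)
    (fun k ↦ |((F lam)^[k] z).im|) ⟨0, Finset.mem_range.2 hn⟩
  set δ := |((F lam)^[k] z).im| with hδ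
  have hδ0 : 0 < δ := abs_pos.2 fun h0 ↦ hz' ⟨k, h0⟩
  have hmin : ∀ m, δ ≤ |((F lam)^[m] z).im| := by
    intro m
    rw [← hper.iterate_mod_apply m]
    exact hk _ (Finset.mem_range.2 (Nat.mod_lt _ hn))
  obtain ⟨y, ⟨m, hm⟩, hy⟩ := Metric.mem_closure_iff.1 hz δ hδ0
  rw [dist_comm, dist_eq_norm] at hy
  have hiter : ∀ m, ‖(F lam)^[m] y - (F lam)^[m] z‖ < δ := by
    intro m
    induction m with
    | zero => exact hy
    | succ m ih =>
      rw [Function.iterate_succ_apply', Function.iterate_succ_apply',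
        F_sub_F (H_eq_of_norm_lt (ih.trans_le (hmin m))).2, norm_mul, hl, one_mul]
      exact ih
  exact (H_eq_of_norm_lt ((hiter m).trans_le (hmin m))).1 hm

/-- On a disc that misses the critical set the iterates are rotations. -/
lemma iterate_sub_iterate {w : ℂ} {ε : ℝ} (hw : Disjoint (Metric.ball w ε) (criticalSet lam))
    (m : ℕ) {z : ℂ} (hz : z ∈ Metric.ball w ε) :
    (F lam)^[m] z - (F lam)^[m] w = lam ^ m * (z - w) := by
  have hε : 0 < ε := Metric.pos_of_mem_ball hz
  induction m generalizing z with
  | zero => simp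
  | succ m ih =>
    rw [Function.iterate_succ_apply', Function.iterate_succ_apply', F_sub_F, ih hz, pow_succ]
    · ring
    · symm
      refine H_eq_of_segment fun t ht h0 ↦ ?_
      have hmem : w + t * (z - w) ∈ Metric.ball w ε := by
        rw [mem_ball_iff_norm] at hz ⊢
        rw [add_sub_cancel_left, norm_mul, Complex.norm_real, norm_of_nonneg ht.1]
        exact (mul_le_of_le_one_left (norm_nonneg _) ht.2).trans_lt hz
      refine Set.disjoint_left.1 hw hmem ⟨m, ?_⟩
      rw [← h0, ih hz]
      congr 1
      rw [← sub_eq_iff_eq_add', ih hmem]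
      ring

/-- If an iterate translates a disc off the critical set, then the image disc is off the critical
set. -/
lemma disjoint_ball_iterate {w : ℂ} {ε : ℝ} (hw : Disjoint (Metric.ball w ε) (criticalSet lam))
    {m : ℕ} (hm : lam ^ m = 1) :
    Disjoint (Metric.ball ((F lam)^[m] w) ε) (criticalSet lam) := by
  rw [Set.disjoint_left] at *
  rintro y hy ⟨k, hk⟩
  have hmem : w + (y - (F lam)^[m] w) ∈ Metric.ball w ε := by
    rw [mem_ball_iff_norm] at *
    rwa [add_sub_cancel_left]
  refine hw hmem ⟨k + m, ?_⟩
  have := iterate_sub_iterate (Set.disjoint_left.2 hw) m hmem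
  rw [hm, one_mul, add_sub_cancel_left, sub_left_inj] at this
  rw [Function.iterate_add_apply, this]
  exact hk

/-- A point off the closed critical set with bounded orbit is eventually periodic, when the
rotation has finite order. -/
lemma exists_periodic_iterate {q : ℕ} (hq : 0 < q) (hlq : lam ^ q = 1) {w : ℂ}
    (hw : w ∉ closure (criticalSet lam)) {R : ℝ} (hR : ∀ m, ‖(F lam)^[m] w‖ ≤ R) :
    ∃ m n, 0 < n ∧ (F lam)^[n] ((F lam)^[m] w) = (F lam)^[m] w := by
  obtain ⟨ε, ε0, hε⟩ : ∃ ε > 0, Disjoint (Metric.ball w ε) (criticalSet lam) := by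
    rw [Metric.mem_closure_iff] at hw
    push Not at hw
    obtain ⟨ε, ε0, hε⟩ := hw
    refine ⟨ε, ε0, Set.disjoint_left.2 fun y hy hy' ↦ ?_⟩
    rw [Metric.mem_ball, dist_comm] at hy
    exact (hε y hy').not_gt hy
  -- Only times divisible by `q` are used, so that the iterates act on the disc as translations.
  obtain ⟨x, -, φ, hφ, hlim⟩ := (isCompact_closedBall (0 : ℂ) R).tendsto_subseq
    (x := fun m ↦ (F lam)^[q * m] w) (fun m ↦ by simpa using hR _)
  obtain ⟨K, hK⟩ := Metric.cauchySeq_iff.1 hlim.cauchySeq ε ε0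
  have hc := hK (K + 1) (by lia) K le_rfl
  have hlt := hφ (Nat.lt_succ_self K)
  simp only [Function.comp_apply] at hc
  set y := (F lam)^[q * φ K] w with hy
  set n := q * (φ (K + 1) - φ K) with hn
  have hn0 : 0 < n := Nat.mul_pos hq (by simp only [Nat.succ_eq_add_one] at hlt; lia)
  have hln : lam ^ n = 1 := by rw [hn, pow_mul, hlq, one_pow]
  have hny : (F lam)^[q * φ (K + 1)] w = (F lam)^[n] y := by
    rw [hy, ← Function.iterate_add_apply, hn, ← mul_add, Nat.sub_add_cancel hlt.le]
  rw [hny, dist_eq_norm] at hc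
  set c := (F lam)^[n] y - y with hcdef
  have hyε : Disjoint (Metric.ball y ε) (criticalSet lam) :=
    disjoint_ball_iterate hε (by rw [pow_mul, hlq, one_pow])
  -- Since `‖c‖ < ε`, the next centre lies in the present disc, which `F^n` translates by `c`; so
  -- the displacement reproduces itself.
  have key : ∀ k : ℕ, Disjoint (Metric.ball (y + k * c) ε) (criticalSet lam) ∧
      (F lam)^[n] (y + k * c) = y + (k + 1 : ℕ) * c := by
    intro k
    induction k with
    | zero => simp [hyε, hcdef]
    | succ k ih =>
      obtain ⟨h1, h2⟩ := ih
      refine ⟨by rw [← h2]; exact disjoint_ball_iterate h1 hln, ?_⟩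
      have hmem : y + (k + 1 : ℕ) * c ∈ Metric.ball (y + k * c) ε := by
        rw [mem_ball_iff_norm]
        convert hc using 2
        push_cast; ring
      have := iterate_sub_iterate h1 n hmem
      rw [hln, h2, sub_eq_iff_eq_add] at this
      rw [this]
      push_cast; ring
  have horbit : ∀ k : ℕ, (F lam)^[n * k] y = y + k * c := by
    intro k
    induction k with
    | zero => simp
    | succ k ih =>
      rw [Nat.mul_succ, Nat.add_comm, Function.iterate_add_apply, ih, (key k).2]
  have hc0 : c = 0 := by
    by_contra hne
    obtain ⟨k, hk⟩ := exists_nat_gt (2 * R / ‖c‖)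
    rw [div_lt_iff₀ (norm_pos_iff.2 hne)] at hk
    have b1 := hR (n * k + q * φ K)
    have b2 := hR (q * φ K)
    rw [Function.iterate_add_apply, ← hy, horbit] at b1
    rw [← hy] at b2
    have b3 := norm_sub_le (y + k * c) y
    rw [add_sub_cancel_left, norm_mul, Complex.norm_natCast] at b3
    linarith
  exact ⟨q * φ K, n, hn0, sub_eq_zero.1 hc0⟩

lemma forwardCriticalSet_subset_closure {q : ℕ} (hq : 0 < q) (hlq : lam ^ q = 1)
    (hb : ∀ w ∉ criticalSet lam, ∃ R, ∀ m, ‖(F lam)^[m] w‖ ≤ R) :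
    forwardCriticalSet lam ⊆ closure (criticalSet lam) := by
  intro w hw
  simp only [forwardCriticalSet, Set.mem_iUnion] at hw
  obtain ⟨i, -, x, ⟨t, rfl⟩, rfl⟩ := hw
  by_contra hcl
  have hl : lam ≠ 0 := by
    rintro rfl
    rw [zero_pow hq.ne'] at hlq
    exact zero_ne_one hlq
  obtain ⟨R, hR⟩ := hb _ fun h ↦ hcl (subset_closure h)
  obtain ⟨m, n, hn, hper⟩ := exists_periodic_iterate hq hlq hcl hR
  rw [← Function.iterate_add_apply _ m, ← Function.iterate_add_apply, add_comm,
    Function.iterate_add_apply _ (m + i)] at hper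
  have hx : Function.IsPeriodicPt (F lam) n (t : ℂ) := ((F_injective hl).iterate (m + i)) hper
  -- After `n * i - i` further steps the orbit of `F^i(t)` has made `n * i` steps from `t`, a
  -- multiple of the period, so it is back at the real point `t`.
  refine hcl (subset_closure ⟨n * i - i, ?_⟩)
  rw [← Function.iterate_add_apply, Nat.sub_add_cancel (Nat.le_mul_of_pos_left i hn),
    (hx.mul_const i).eq]
  exact Complex.ofReal_im t

lemma forwardCriticalSet_subset_of_im_eq_zero (hl : lam.im = 0) :
    forwardCriticalSet lam ⊆ criticalSet lam := by
  intro w hw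
  simp only [forwardCriticalSet, Set.mem_iUnion] at hw
  obtain ⟨i, -, x, ⟨t, rfl⟩, rfl⟩ := hw
  refine ⟨0, ?_⟩
  rw [Function.iterate_zero, id]
  induction i with
  | zero => simp
  | succ i ih =>
    rw [Function.iterate_succ_apply']
    rw [F, H, if_pos ih.ge]
    simp [hl, ih]

end General

end PiecewiseRotation

end

theorem mainTheorem3 (p q : ℕ) (hq : 0 < q) (hpq : Nat.Coprime p q) (lam : ℂ)
    (hlam : lam = Complex.exp (((2 * Real.pi * (p : ℝ) / (q : ℝ) : ℝ) : ℂ) * Complex.I)) :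
    (∀ z ∈ closure (PiecewiseRotation.criticalSet lam) \ PiecewiseRotation.criticalSet lam,
        PiecewiseRotation.IsAperiodic (PiecewiseRotation.F lam) z) ∧
      PiecewiseRotation.forwardCriticalSet lam ⊆
        closure (PiecewiseRotation.criticalSet lam) := by
  have hnorm : ‖lam‖ = 1 := by rw [hlam, Complex.norm_exp_ofReal_mul_I]
  refine ⟨fun z hz ↦ PiecewiseRotation.isAperiodic_of_mem_closure hnorm hz.1 hz.2, ?_⟩
  -- The reduced fraction is that of `2p / q` rather than `p / q`: directions of lines matter only
  -- modulo `π`, and `lam = exp (π * I * r / h)`.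
  obtain ⟨r, h, hrh, hr, hh⟩ := Nat.exists_coprime (2 * p) q
  set g := Nat.gcd (2 * p) q
  have hg0 : 0 < g := Nat.gcd_pos_of_pos_right _ hq
  have hh0 : 0 < h := Nat.pos_of_mul_pos_right (hh ▸ hq)
  have hα : 2 * (h : ℝ) * (Real.pi / (2 * h)) = Real.pi := by field_simp
  have hdir : lam = PiecewiseRotation.dir (2 * (r : ℤ) * (Real.pi / (2 * h))) := by
    rw [hlam, PiecewiseRotation.dir_eq_exp]
    congr 3
    have e1 : 2 * (p : ℝ) = r * g := by exact_mod_cast hr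
    have e2 : (q : ℝ) = h * g := by exact_mod_cast hh
    rw [show 2 * Real.pi * (p : ℝ) = Real.pi * (2 * p) by ring, e1, e2, Int.cast_natCast]
    field_simp
  have hlq : lam ^ q = 1 := by
    rw [hlam, ← Complex.exp_nat_mul, Complex.exp_eq_one_iff]
    refine ⟨p, ?_⟩
    have : (q : ℂ) ≠ 0 := by exact_mod_cast hq.ne'
    push_cast
    field_simp
  rcases (by lia : h = 1 ∨ 2 ≤ h) with rfl | h2
  · refine (PiecewiseRotation.forwardCriticalSet_subset_of_im_eq_zero ?_).trans subset_closure
    rw [hdir, PiecewiseRotation.dir_im, show 2 * (((r : ℤ) : ℝ)) * (Real.pi / (2 * (1 : ℕ))) =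
      r * Real.pi by push_cast; ring]
    exact Real.sin_nat_mul_pi r
  · refine PiecewiseRotation.forwardCriticalSet_subset_closure hq hlq fun w hw ↦ ?_
    rw [hdir] at hw ⊢
    exact PiecewiseRotation.exists_norm_iterate_le h2 (Nat.isCoprime_iff_coprime.2 hrh) hα hw
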